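/- For real $\nu$ and $z>0$ let $$f_\nu(z)={}_1F_0(1;-;z)_\nu:=\nu\,F(1,1-\nu;2;1-z)$$ be the incomplete geometric series, where $F={}_2F_1$ is the Gauss hypergeometric function: on $(-1,1)$ it is the sum of the Gauss series, and on $(-\infty,1)$ its analytic continuation. Let $\Lambda_\omega=\omega+z\,\frac{d}{dz}$, and for a differential operator $\mathcal D$ put $(\mathcal D)^{(0)}=1$, $(\mathcal D)^{(n)}=\prod_{k=0}^{n-1}(\mathcal D-k)$ for $n\ge 1$. For integers $0\le\omega\le n$ and $z>0$ define $$g_{n,\omega}(z,\nu)=(\Lambda_\omega)^{(n)}f_\nu(z),\qquad \tilde g_{n,\omega}(z,\nu)=\frac{g_{n,\omega}(z,\nu)}{f_\nu(z)},$$ and let $\tilde g_{n,\omega}(0,\nu)=\lim_{z\to0^+}\tilde g_{n,\omega}(z,\nu)$. **Theorem.** Let $\nu\in\mathbb R$. If $\nu>1$, then 1. for all integers $0\le\omega\le n$, the limit defining $\tilde g_{n,\omega}(0,\nu)$ exists and is finite, and $z\mapsto|\tilde g_{n,\omega}(z,\nu)|$ is increasing (not necessarily strictly) on $[0,\infty)$;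 2. there exist integers $0\le\omega\le n$ such that $z\mapsto|\tilde g_{n,\omega}(z,\nu)|$ is strictly increasing on $[0,\infty)$. If $\nu<-1$, the same holds with "increasing" replaced by "decreasing" in both items. -/

import Mathlib

open Set Filter Topology

noncomputable section

namespace FracGeom

/-- `G` is the analytic continuation of the Gauss hypergeometric series
`∑ (a)ₖ (b)ₖ / ((c)ₖ k!) xᵏ` from `(-1, 1)` to the half-line `(-∞, 1)`, i.e. the restriction to the
real axis of the principal branch. By the identity theorem its values on `(-∞, 1)` are unique. -/
def IsGaussContinuation (a b c : ℝ) (G : ℝ → ℝ) : Prop :=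
  AnalyticOnNhd ℝ G (Iio 1) ∧ ∀ x ∈ Ioo (-1 : ℝ) 1, G x = ordinaryHypergeometric a b c x

open Classical in
/-- The Gauss hypergeometric function `F(a, b; c; x)` for real `x < 1`: the sum of the Gauss series
for `|x| < 1`, and its analytic continuation for `x ≤ -1`. -/
def hyperF (a b c x : ℝ) : ℝ :=
  if h : ∃ G : ℝ → ℝ, IsGaussContinuation a b c G then Classical.choose h x else 0

/-- The incomplete geometric series `₁F₀(1; -; z)_ν = ν F(1, 1 - ν; 2; 1 - z)`, for `z > 0`. -/
def incGeom (ν z : ℝ) : ℝ := ν * hyperF 1 (1 - ν) 2 (1 - z)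

/-- The operator `ϑ = z ∂_z`. -/
def theta (h : ℝ → ℝ) : ℝ → ℝ := fun z => z * deriv h z

/-- The lowering operator `Λ_ω = ω + ϑ`. -/
def lowering (ω : ℝ) (h : ℝ → ℝ) : ℝ → ℝ := fun z => ω * h z + theta h z

/-- The factorial operator `(D)^{(n)} = D (D - 1) ⋯ (D - (n - 1))`, with `(D)^{(0)} = 1`. -/
def factorialOp (D : (ℝ → ℝ) → ℝ → ℝ) : ℕ → (ℝ → ℝ) → ℝ → ℝ
  | 0, h => h
  | n + 1, h => fun z => D (factorialOp D n h) z - n * factorialOp D n h z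

/-- `g_{n,ω}(z, ν) = (Λ_ω)^{(n)} ₁F₀(1; -; z)_ν`, for `z > 0`. -/
def g (n ω : ℕ) (z ν : ℝ) : ℝ := factorialOp (lowering ω) n (incGeom ν) z

/-- `g̃_{n,ω}(z, ν) = g_{n,ω}(z, ν) / ₁F₀(1; -; z)_ν` for `z > 0`, extended to `z = 0` by its limit
as `z → 0⁺` (for `ν < 0` the denominator has a pole at `z = 0`). -/
def gTilde (n ω : ℕ) (z ν : ℝ) : ℝ :=
  if z = 0 then limUnder (𝓝[>] (0 : ℝ)) (fun t => g n ω t ν / incGeom ν t)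
  else g n ω z ν / incGeom ν z

end FracGeom

end

namespace FracGeom


/-! For `ν ≠ 0`, `f_ν(z)` is `(z ^ ν - 1) / (z - 1)`, that is `ν ∫₀¹ (1 - t + t z) ^ (ν - 1) dt`.
Since `(Λ_ω)^{(n)} = z^{n-ω} ∂ⁿ z^ω`, and `z^ω f_ν` differs from `f_{ν+ω}` by a polynomial of degree
`< ω ≤ n` which `∂ⁿ` kills, `g_{n,ω}` is again an Euler integral (`g_eq`). Hence `g̃_{n,ω}` is a
constant times the mean of `(t z / (1 - t + t z)) ^ (n - ω) * t ^ ω` under the density proportional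
to `(1 - t + t z) ^ (ν - 1)` (`gTilde_eq`).

Let `ν > 1`. As `z` grows, the averaged function grows pointwise; it is also increasing in `t`,
while the density has a monotone likelihood ratio, so Chebyshev's inequality makes the mean grow
(`momentMean_monotoneOn`). A change of variable trades `(ν, z)` for `(-ν, z⁻¹)`
(`momentMean_eq_inv`), which reverses monotonicity and gives `ν < -1`. The means lie in `[0, 1]`, so
the limits at `0` are finite. The pair `n = ω = 1` is a strict case. -/

/-! ### Closed form of the incomplete geometric series. -/

/-- The Gauss series of `F(1, 1 - ν; 2; x)` sums to `(1 - (1 - x) ^ ν) / (ν x)`. -/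
theorem hypergeometric_mul_eq (ν : ℝ) {x : ℝ} (hx : x ∈ Ioo (-1 : ℝ) 1) :
    ν * x * ordinaryHypergeometric 1 (1 - ν) 2 x = 1 - (1 - x) ^ ν := by
  have hmem : x ∈ Metric.eball (0 : ℝ) 1 := by
    rw [← ENNReal.ofReal_one, Metric.eball_ofReal]
    simpa [abs_lt] using hx
  have hs := (Real.one_div_one_sub_rpow_hasFPowerSeriesOnBall_zero (-ν)).hasSum hmem
  have hcoef (n : ℕ) : Ring.choose (-ν + n - 1) n =
      (n.factorial : ℝ)⁻¹ * (ascPochhammer ℝ n).eval (-ν) := by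
    rw [← Ring.multichoose_eq]
    have h := Ring.factorial_nsmul_multichoose_eq_ascPochhammer (-ν) n
    rw [Polynomial.ascPochhammer_smeval_eq_eval, nsmul_eq_mul] at h
    rw [← h, ← mul_assoc, inv_mul_cancel₀ (by positivity), one_mul]
  simp only [FormalMultilinearSeries.ofScalars_apply_eq, zero_add, hcoef, smul_eq_mul] at hs
  have h1x : 0 < 1 - x := by linarith [hx.2]
  rw [Real.rpow_neg h1x.le, one_div, inv_inv] at hs
  -- Removing the constant term of the binomial series shifts the index, and `(-ν)_{n+1} = -ν (1 -
  -- ν)_n` turns its coefficients into those of the Gauss series.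
  have hs' := (hasSum_nat_add_iff' 1).mpr hs
  rw [ordinaryHypergeometric_eq_tsum, ← tsum_mul_left]
  have h2 : 1 - (1 - x) ^ ν = -((1 - x) ^ ν - ∑ i ∈ Finset.range 1,
      (i.factorial : ℝ)⁻¹ * (ascPochhammer ℝ i).eval (-ν) * x ^ i) := by simp
  rw [h2, ← hs'.neg.tsum_eq]
  refine tsum_congr fun n => ?_
  have hasc2 : (ascPochhammer ℝ n).eval (2 : ℝ) = ((n + 1).factorial : ℝ) := by
    have := Nat.factorial_mul_ascFactorial 1 n
    have h3 := ascPochhammer_nat_eq_natCast_ascFactorial ℝ 2 n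
    simp only [Nat.factorial_one, one_mul] at this
    rw [show (1 : ℕ) + 1 = 2 from rfl] at this
    rw [add_comm n 1, ← this]
    exact_mod_cast h3
  have hsucc : (ascPochhammer ℝ (n + 1)).eval (-ν) = -ν * (ascPochhammer ℝ n).eval (1 - ν) := by
    rw [ascPochhammer_succ_left]
    simp [Polynomial.eval_comp, neg_add_eq_sub]
  rw [hsucc, hasc2, ascPochhammer_eval_one, smul_eq_mul, inv_mul_cancel₀ (by positivity)]
  ring

theorem one_le_radius_hypergeometric (ν : ℝ) :
    1 ≤ (ordinaryHypergeometricSeries ℝ (1 : ℝ) (1 - ν) 2).radius := by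
  by_cases h : ∃ k : ℕ, (k : ℝ) = -(1 - ν)
  · obtain ⟨k, hk⟩ := h
    rw [show 1 - ν = -(k : ℝ) by linarith, ordinaryHypergeometric_radius_top_of_neg_nat₂]
    exact le_top
  · push Not at h
    refine (ordinaryHypergeometricSeries_radius_eq_one ℝ (1 : ℝ) (1 - ν) 2 fun k => ?_).ge
    have : (0 : ℝ) ≤ k := k.cast_nonneg
    exact ⟨by intro h; linarith, h k, by intro h; linarith⟩

theorem analyticAt_hypergeometric (ν : ℝ) {x : ℝ} (hx : x ∈ Ioo (-1 : ℝ) 1) :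
    AnalyticAt ℝ (ordinaryHypergeometric 1 (1 - ν) 2 : ℝ → ℝ) x := by
  have hr := one_le_radius_hypergeometric ν
  have hb := (ordinaryHypergeometricSeries ℝ (1 : ℝ) (1 - ν) 2).hasFPowerSeriesOnBall
    (lt_of_lt_of_le one_pos hr)
  refine hb.analyticAt_of_mem (Metric.eball_subset_eball hr ?_)
  rw [← ENNReal.ofReal_one, Metric.eball_ofReal]
  simpa [abs_lt] using hx

theorem analyticAt_one_sub_rpow (ν : ℝ) {x : ℝ} (hx : x < 1) :
    AnalyticAt ℝ (fun x : ℝ => (1 - x) ^ ν) x := by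
  exact ContDiffAt.analyticAt <| (contDiffAt_const.sub contDiffAt_id).rpow_const_of_ne (sub_pos.mpr hx).ne'

/-- The closed form is `0 / 0` at `x = 0`, so the series is kept on `(-1, 1)`; the two agree on
`(-1, 0)`, where they are glued. -/
theorem exists_isGaussContinuation {ν : ℝ} (hν : ν ≠ 0) :
    ∃ G : ℝ → ℝ, IsGaussContinuation 1 (1 - ν) 2 G := by
  classical
  refine ⟨fun x => if x ∈ Ioo (-1 : ℝ) 1 then ordinaryHypergeometric 1 (1 - ν) 2 x
    else (1 - (1 - x) ^ ν) / (ν * x), fun x hx => ?_, fun x hx => if_pos hx⟩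
  rcases lt_or_ge (-1) x with h | h
  · refine (analyticAt_hypergeometric ν ⟨h, hx⟩).congr ?_
    filter_upwards [Ioo_mem_nhds h hx] with y hy
    rw [if_pos hy]
  · have h0 : x < 0 := by linarith
    have han : AnalyticAt ℝ (fun x : ℝ => (1 - (1 - x) ^ ν) / (ν * x)) x := by
      exact (analyticAt_const.sub (analyticAt_one_sub_rpow ν hx)).div
        (analyticAt_const.mul analyticAt_id) (mul_ne_zero hν h0.ne)
    refine han.congr ?_
    filter_upwards [Iio_mem_nhds h0] with y hy
    split_ifs with hy'
    · rw [← hypergeometric_mul_eq ν hy', mul_div_cancel_left₀ _ (mul_ne_zero hν hy.ne)]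
    · rfl

/-- Without a denominator, both sides are analytic on all of `(-∞, 1)` in `x = 1 - z`, so the
identity theorem extends the equality from `(-1, 1)`. -/
theorem sub_one_mul_incGeom {ν : ℝ} (hν : ν ≠ 0) {z : ℝ} (hz : 0 < z) :
    (z - 1) * incGeom ν z = z ^ ν - 1 := by
  have hG : IsGaussContinuation 1 (1 - ν) 2 (hyperF 1 (1 - ν) 2) := by
    have h := exists_isGaussContinuation hν
    have he : hyperF 1 (1 - ν) 2 = Classical.choose h := by
      funext x
      rw [hyperF, dif_pos h]
    rw [he]
    exact Classical.choose_spec h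
  have h1 : AnalyticOnNhd ℝ (fun x => ν * x * hyperF 1 (1 - ν) 2 x) (Iio 1) := fun x hx =>
    (analyticAt_const.mul analyticAt_id).mul (hG.1 x hx)
  have h2 : AnalyticOnNhd ℝ (fun x : ℝ => 1 - (1 - x) ^ ν) (Iio 1) := fun x hx =>
    analyticAt_const.sub (analyticAt_one_sub_rpow ν hx)
  have h3 := h1.eqOn_of_preconnected_of_eventuallyEq h2 isPreconnected_Iio
    (show (0 : ℝ) ∈ Iio 1 by simp) (by
      filter_upwards [Ioo_mem_nhds (show (-1 : ℝ) < 0 by simp) (show (0 : ℝ) < 1 by simp)]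
        with y hy
      rw [hG.2 y hy, hypergeometric_mul_eq ν hy])
  have h4 := h3 (show 1 - z ∈ Iio 1 by simpa using hz)
  simp only [sub_sub_cancel] at h4
  rw [incGeom]
  linarith

theorem incGeom_one {ν : ℝ} (hν : ν ≠ 0) : incGeom ν 1 = ν := by
  have h := exists_isGaussContinuation hν
  rw [incGeom, hyperF, dif_pos h, sub_self, (Classical.choose_spec h).2 0 (by simp),
    ordinaryHypergeometric_zero, mul_one]


/-! ### Euler integrals and the formula for `g`. -/

/-- The Euler-type integral `∫₀¹ tⁿ (1 - t + t z)^(μ - 1 - n) dt`. -/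
noncomputable def eulerInt (μ : ℝ) (n : ℕ) (z : ℝ) : ℝ :=
  ∫ t in (0 : ℝ)..1, t ^ n * (1 - t + t * z) ^ (μ - 1 - n)

theorem segment_pos {z t : ℝ} (hz : 0 < z) (ht : t ∈ Icc (0 : ℝ) 1) : 0 < 1 - t + t * z := by
  rcases ht.1.eq_or_lt with h | h
  · simp [← h]
  · have := mul_pos h hz
    linarith [ht.2]

theorem continuousOn_segment_rpow {z : ℝ} (hz : 0 < z) (a : ℝ) :
    ContinuousOn (fun t : ℝ => (1 - t + t * z) ^ a) (Icc 0 1) := by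
  refine ContinuousOn.rpow_const (by fun_prop) fun t ht => Or.inl (segment_pos hz ht).ne'

theorem hasDerivAt_eulerInt (μ : ℝ) (n : ℕ) {z : ℝ} (hz : 0 < z) :
    HasDerivAt (eulerInt μ n) ((μ - 1 - n) * eulerInt μ (n + 1) z) z := by
  have hcont (m : ℕ) (a : ℝ) {y : ℝ} (hy : 0 < y) :
      ContinuousOn (fun t : ℝ => t ^ m * (1 - t + t * y) ^ a) (uIcc 0 1) := by
    rw [uIcc_of_le zero_le_one]
    exact (continuousOn_pow m).mul (continuousOn_segment_rpow hy a)
  set a : ℝ := μ - 1 - n with ha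
  set a' : ℝ := μ - 1 - (n + 1 : ℕ) with ha'
  have haa : a - 1 = a' := by rw [ha, ha']; push_cast; ring
  have hmeas (m : ℕ) (a : ℝ) {y : ℝ} (hy : 0 < y) :
      MeasureTheory.AEStronglyMeasurable (fun t : ℝ => t ^ m * (1 - t + t * y) ^ a)
        (MeasureTheory.volume.restrict (uIoc 0 1)) :=
    ((hcont m a hy).mono uIoc_subset_uIcc).aestronglyMeasurable measurableSet_uIoc
  -- a uniform bound on the derivative of the integrand near `z`
  have hcpt : IsCompact (Icc (z / 2) (2 * z) ×ˢ Icc (0 : ℝ) 1) := isCompact_Icc.prod isCompact_Icc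
  obtain ⟨C, hC⟩ := hcpt.exists_bound_of_continuousOn
    (f := fun p : ℝ × ℝ => a * (p.2 ^ (n + 1) * (1 - p.2 + p.2 * p.1) ^ a')) (by
      refine continuousOn_const.mul (ContinuousOn.mul (by fun_prop) ?_)
      refine ContinuousOn.rpow_const (by fun_prop) fun p hp => Or.inl ?_
      exact (segment_pos (by linarith [hp.1.1]) hp.2).ne')
  have key := intervalIntegral.hasDerivAt_integral_of_dominated_loc_of_deriv_le
    (μ := MeasureTheory.volume) (a := 0) (b := 1) (x₀ := z) (s := Icc (z / 2) (2 * z))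
    (F := fun y t => t ^ n * (1 - t + t * y) ^ a)
    (F' := fun y t => a * (t ^ (n + 1) * (1 - t + t * y) ^ a')) (bound := fun _ => C)
    (Icc_mem_nhds (by linarith) (by linarith))
    (by filter_upwards [Ioi_mem_nhds hz] with y hy using hmeas n a hy)
    ((hcont n a hz).intervalIntegrable)
    ((hmeas (n + 1) a' hz).const_mul a)
    (by
      refine .of_forall fun t ht y hy => hC (y, t) ⟨hy, ?_⟩
      rw [uIoc_of_le zero_le_one] at ht
      exact Ioc_subset_Icc_self ht)
    intervalIntegrable_const
    (by
      refine .of_forall fun t ht y hy => ?_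
      rw [uIoc_of_le zero_le_one] at ht
      have hp := segment_pos (z := y) (by linarith [hy.1]) (Ioc_subset_Icc_self ht)
      have h1 : HasDerivAt (fun y : ℝ => 1 - t + t * y) (t * 1) y :=
        ((hasDerivAt_id y).const_mul t).const_add (1 - t)
      have h2 := (h1.rpow_const (p := a) (Or.inl hp.ne')).const_mul (t ^ n)
      rw [haa] at h2
      convert! h2 using 1
      ring)
  have h := key.2
  rw [intervalIntegral.integral_const_mul] at h
  exact h

theorem incGeom_eq_eulerInt {ν : ℝ} (hν : ν ≠ 0) {z : ℝ} (hz : 0 < z) :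
    incGeom ν z = ν * eulerInt ν 0 z := by
  by_cases h1 : z = 1
  · subst h1
    simp [incGeom_one hν, eulerInt]
  have hz1 : z - 1 ≠ 0 := sub_ne_zero.mpr h1
  apply mul_left_cancel₀ hz1
  rw [sub_one_mul_incGeom hν hz, eulerInt, ← intervalIntegral.integral_const_mul,
    ← intervalIntegral.integral_const_mul,
    -- The factor `z - 1` is the inner derivative, so the integrand has the primitive `(1 - t + t *
    -- z) ^ ν`.
    intervalIntegral.integral_eq_sub_of_hasDerivAt (f := fun t => (1 - t + t * z) ^ ν)]
  · simp
  · intro t ht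
    rw [uIcc_of_le zero_le_one] at ht
    have h1 : HasDerivAt (fun t : ℝ => 1 - t + t * z) (-1 + 1 * z) t :=
      ((hasDerivAt_id t).const_sub 1).add ((hasDerivAt_id t).mul_const z)
    convert! h1.rpow_const (p := ν) (Or.inl (segment_pos hz ht).ne') using 1
    simp
    ring
  · refine ContinuousOn.intervalIntegrable ?_
    rw [uIcc_of_le zero_le_one]
    simp only [pow_zero, one_mul]
    exact continuousOn_const.mul (continuousOn_const.mul (continuousOn_segment_rpow hz _))

theorem sub_one_mul_eulerInt {ν : ℝ} {z : ℝ} (hz : 0 < z) :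
    (z - 1) * (ν * eulerInt ν 0 z) = z ^ ν - 1 := by
  by_cases hν : ν = 0
  · simp [hν]
  · rw [← incGeom_eq_eulerInt hν hz, sub_one_mul_incGeom hν hz]

theorem pow_mul_eulerInt (ν : ℝ) (ω : ℕ) {z : ℝ} (hz : 0 < z) :
    z ^ ω * (ν * eulerInt ν 0 z) =
      (ν + ω) * eulerInt (ν + ω) 0 z - ∑ k ∈ Finset.range ω, z ^ k := by
  by_cases h1 : z = 1
  · subst h1
    simp [eulerInt]
  apply mul_left_cancel₀ (sub_ne_zero.mpr h1)
  rw [mul_sub, sub_one_mul_eulerInt hz, mul_geom_sum, mul_left_comm, sub_one_mul_eulerInt hz,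
    Real.rpow_add hz, Real.rpow_natCast]
  ring

/-- `(Λ_ω)^{(n)} = z^{n - ω} ∂ⁿ z^ω` on the positive half-line. -/
theorem pow_mul_factorialOp (ω : ℕ) (h : ℝ → ℝ) (u : ℕ → ℝ → ℝ)
    (hu0 : ∀ z, 0 < z → u 0 z = z ^ ω * h z)
    (hu : ∀ k z, 0 < z → HasDerivAt (u k) (u (k + 1) z) z) (n : ℕ) :
    ∀ z, 0 < z → z ^ ω * factorialOp (lowering ω) n h z = z ^ n * u n z := by
  induction n with
  | zero => intro z hz; simp [factorialOp, hu0 z hz]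
  | succ n ih =>
    intro z hz
    have heq : factorialOp (lowering ω) n h =ᶠ[𝓝 z] fun y => y ^ n * u n y / y ^ ω := by
      filter_upwards [Ioi_mem_nhds hz] with y hy
      rw [← ih y hy, mul_div_cancel_left₀ _ (pow_pos hy ω).ne']
    have hd := ((((hasDerivAt_pow n z).mul (hu n z hz)).div (hasDerivAt_pow ω z)
      (pow_pos hz ω).ne').congr_of_eventuallyEq heq).deriv
    simp only [factorialOp, lowering, theta]
    rw [hd, heq.eq_of_nhds]
    have hn : (n : ℝ) * z ^ (n - 1) * z = n * z ^ n := by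
      cases n <;> simp [pow_succ, mul_assoc]
    have hω : (ω : ℝ) * z ^ (ω - 1) * z = ω * z ^ ω := by
      cases ω <;> simp [pow_succ, mul_assoc]
    simp only [Pi.mul_apply]
    field_simp
    rw [pow_succ]
    linear_combination (u n z * z ^ ω) * hn - (z ^ n * u n z) * hω

theorem g_eq {ν : ℝ} (hν : ν ≠ 0) {n ω : ℕ} (hω : ω ≤ n) {z : ℝ} (hz : 0 < z) :
    g n ω z ν = (∏ k ∈ Finset.range (n + 1), (ν + ω - k)) *
      (z ^ (n - ω) * eulerInt (ν + ω) n z) := by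
  -- `P` is the geometric sum separating `z^ω f_ν` from `f_{ν+ω}`; its degree is below `n`, so its
  -- `n`-th derivative vanishes.
  let P : Polynomial ℝ := ∑ k ∈ Finset.range ω, Polynomial.X ^ k
  have hP : P.degree < n := by
    refine (Polynomial.degree_sum_le _ _).trans_lt ?_
    rw [Finset.sup_lt_iff (by exact_mod_cast WithBot.bot_lt_coe n)]
    intro k hk
    rw [Polynomial.degree_X_pow]
    exact_mod_cast (Finset.mem_range.mp hk).trans_le hω
  have h := pow_mul_factorialOp ω (incGeom ν)
    (fun m z => (∏ k ∈ Finset.range (m + 1), (ν + ω - k)) * eulerInt (ν + ω) m z -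
      (Polynomial.derivative^[m] P).eval z)
    (fun z hz => by
      rw [incGeom_eq_eulerInt hν hz, pow_mul_eulerInt ν ω hz]
      simp [P, Polynomial.eval_finsetSum])
    (fun m z hz => by
      convert! ((hasDerivAt_eulerInt (ν + ω) m hz).const_mul
        (∏ k ∈ Finset.range (m + 1), (ν + ω - (k : ℝ)))).sub
        ((Polynomial.derivative^[m] P).hasDerivAt z) using 1
      rw [Function.iterate_succ_apply', Finset.prod_range_succ _ (m + 1)]
      push_cast
      ring) n z hz
  simp only [Polynomial.iterate_derivative_eq_zero_of_degree_lt hP, Polynomial.eval_zero,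
    sub_zero] at h
  apply mul_left_cancel₀ (pow_pos hz ω).ne'
  rw [g, h, ← Nat.add_sub_of_le hω, pow_add, Nat.add_sub_cancel_left, Nat.add_sub_of_le hω]
  ring


/-! ### Chebyshev's integral inequality with a weight. -/

section Chebyshev

variable {a b : ℝ} {h p w : ℝ → ℝ}

/-- The mean value `p c` of `p` with respect to the weight `w`, in the form used for Chebyshev's
integral inequality. -/
theorem exists_weighted_mean (hab : a ≤ b) (hh : ContinuousOn h (Icc a b))
    (hp : ContinuousOn p (Icc a b)) (hw : ContinuousOn w (Icc a b))
    (hw0 : ∀ t ∈ Icc a b, 0 ≤ w t) :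
    ∃ c ∈ Icc a b, (∫ t in a..b, (h t - h c) * (p t - p c) * w t) * (∫ t in a..b, w t) =
      (∫ t in a..b, h t * (p t * w t)) * (∫ t in a..b, w t) -
        (∫ t in a..b, h t * w t) * ∫ t in a..b, p t * w t := by
  -- With `∫ p w = p c * ∫ w`, the two terms containing `h c` cancel when the product is expanded.
  obtain ⟨c, hc, hce⟩ := exists_eq_const_mul_intervalIntegral_of_nonneg (f := p) (g := w)
    (μ := MeasureTheory.volume) (by rwa [uIcc_of_le hab]) (hw.intervalIntegrable_of_Icc hab)
    (fun t ht => hw0 t (by rw [uIoc_of_le hab] at ht; exact Ioc_subset_Icc_self ht))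
  rw [uIcc_of_le hab] at hc
  refine ⟨c, hc, ?_⟩
  have ii {f : ℝ → ℝ} (hf : ContinuousOn f (Icc a b)) :
      IntervalIntegrable f MeasureTheory.volume a b := hf.intervalIntegrable_of_Icc hab
  have hsplit : (∫ t in a..b, (h t - h c) * (p t - p c) * w t) =
      (∫ t in a..b, h t * (p t * w t)) - p c * (∫ t in a..b, h t * w t) -
        h c * (∫ t in a..b, p t * w t) + h c * p c * ∫ t in a..b, w t := by
    rw [← intervalIntegral.integral_const_mul, ← intervalIntegral.integral_const_mul,
      ← intervalIntegral.integral_const_mul, ← intervalIntegral.integral_sub (ii (by fun_prop))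
        (ii (by fun_prop)), ← intervalIntegral.integral_sub (ii (by fun_prop)) (ii (by fun_prop)),
      ← intervalIntegral.integral_add (ii (by fun_prop)) (ii (by fun_prop))]
    congr 1
    funext t
    ring
  rw [hsplit, hce]
  ring

/-- Chebyshev's integral inequality with a weight. -/
theorem chebyshev_integral_le (hab : a ≤ b) (hh : ContinuousOn h (Icc a b))
    (hp : ContinuousOn p (Icc a b)) (hw : ContinuousOn w (Icc a b))
    (hw0 : ∀ t ∈ Icc a b, 0 ≤ w t) (hhm : MonotoneOn h (Icc a b)) (hpm : MonotoneOn p (Icc a b)) :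
    (∫ t in a..b, h t * w t) * (∫ t in a..b, p t * w t) ≤
      (∫ t in a..b, h t * (p t * w t)) * ∫ t in a..b, w t := by
  obtain ⟨c, hc, he⟩ := exists_weighted_mean hab hh hp hw hw0
  rw [← sub_nonneg, ← he]
  refine mul_nonneg (intervalIntegral.integral_nonneg hab fun t ht => ?_)
    (intervalIntegral.integral_nonneg hab hw0)
  refine mul_nonneg ?_ (hw0 t ht)
  rcases le_total t c with htc | htc
  · exact mul_nonneg_of_nonpos_of_nonpos (sub_nonpos.mpr (hhm ht hc htc))
      (sub_nonpos.mpr (hpm ht hc htc))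
  · exact mul_nonneg (sub_nonneg.mpr (hhm hc ht htc)) (sub_nonneg.mpr (hpm hc ht htc))

theorem integral_pos_of_pos_on_Icc (hab : a < b) (hw : ContinuousOn w (Icc a b))
    (hw0 : ∀ t ∈ Icc a b, 0 < w t) : 0 < ∫ t in a..b, w t :=
  intervalIntegral.intervalIntegral_pos_of_pos_on (hw.intervalIntegrable_of_Icc hab.le)
    (fun t ht => hw0 t (Ioo_subset_Icc_self ht)) hab

/-- Strict form of Chebyshev's integral inequality with a weight. -/
theorem chebyshev_integral_lt (hab : a < b) (hh : ContinuousOn h (Icc a b))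
    (hp : ContinuousOn p (Icc a b)) (hw : ContinuousOn w (Icc a b))
    (hw0 : ∀ t ∈ Icc a b, 0 < w t) (hhm : StrictMonoOn h (Icc a b))
    (hpm : StrictMonoOn p (Icc a b)) :
    (∫ t in a..b, h t * w t) * (∫ t in a..b, p t * w t) <
      (∫ t in a..b, h t * (p t * w t)) * ∫ t in a..b, w t := by
  obtain ⟨c, hc, he⟩ := exists_weighted_mean hab.le hh hp hw fun t ht => (hw0 t ht).le
  rw [← sub_pos, ← he]
  refine mul_pos ?_ (integral_pos_of_pos_on_Icc hab hw hw0)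
  have hpos (t) (ht : t ∈ Icc a b) (hne : t ≠ c) : 0 < (h t - h c) * (p t - p c) * w t := by
    refine mul_pos ?_ (hw0 t ht)
    rcases hne.lt_or_gt with htc | htc
    · exact mul_pos_of_neg_of_neg (sub_neg.mpr (hhm ht hc htc)) (sub_neg.mpr (hpm ht hc htc))
    · exact mul_pos (sub_pos.mpr (hhm hc ht htc)) (sub_pos.mpr (hpm hc ht htc))
  have key := intervalIntegral.integral_lt_integral_of_continuousOn_of_le_of_exists_lt
    (f := fun _ => (0 : ℝ)) (g := fun t => (h t - h c) * (p t - p c) * w t) hab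
    continuousOn_const (((hh.sub continuousOn_const).mul (hp.sub continuousOn_const)).mul hw)
    (fun t ht => by
      by_cases htc : t = c
      · simp [htc]
      · exact (hpos t (Ioc_subset_Icc_self ht) htc).le)
    (by
      by_cases hac : a = c
      · exact ⟨b, right_mem_Icc.mpr hab.le, hpos b (right_mem_Icc.mpr hab.le) (by
          rw [← hac]; exact hab.ne')⟩
      · exact ⟨a, left_mem_Icc.mpr hab.le, hpos a (left_mem_Icc.mpr hab.le) hac⟩)
  simpa using key

end Chebyshev

/-! ### `g̃` as a constant times a weighted mean. -/

/-- The numerator `∫₀¹ (t z / (1 - t + t z))ᵐ tᵏ (1 - t + t z)^(ν - 1) dt`. -/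
noncomputable def momentInt (m k : ℕ) (ν z : ℝ) : ℝ :=
  ∫ t in (0 : ℝ)..1, (t * z / (1 - t + t * z)) ^ m * t ^ k * (1 - t + t * z) ^ (ν - 1)

/-- The mean of `(t z / (1 - t + t z))ᵐ tᵏ` over `[0, 1]` with respect to the probability density
proportional to `(1 - t + t z)^(ν - 1)`. -/
noncomputable def momentMean (m k : ℕ) (ν z : ℝ) : ℝ := momentInt m k ν z / eulerInt ν 0 z

theorem momentInt_zero_zero (ν z : ℝ) : momentInt 0 0 ν z = eulerInt ν 0 z := by
  simp [momentInt, eulerInt]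

theorem eulerInt_zero_pos (ν : ℝ) {z : ℝ} (hz : 0 < z) : 0 < eulerInt ν 0 z := by
  simp only [eulerInt, pow_zero, one_mul]
  exact integral_pos_of_pos_on_Icc one_pos (continuousOn_segment_rpow hz _)
    fun t ht => Real.rpow_pos_of_pos (segment_pos hz ht) _

/-- The exponent `ν + ω - 1 - n` equals `ν - 1 - (n - ω)`; the surplus `n - ω` denominators pair
with as many factors `t * z`. -/
theorem pow_mul_eulerInt_eq_momentInt (ν : ℝ) {n ω : ℕ} (hω : ω ≤ n) {z : ℝ} (hz : 0 < z) :
    z ^ (n - ω) * eulerInt (ν + ω) n z = momentInt (n - ω) ω ν z := by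
  obtain ⟨m, rfl⟩ := Nat.exists_eq_add_of_le hω
  rw [Nat.add_sub_cancel_left, eulerInt, momentInt, ← intervalIntegral.integral_const_mul]
  refine intervalIntegral.integral_congr fun t ht => ?_
  rw [uIcc_of_le zero_le_one] at ht
  have hL := segment_pos hz ht
  have he : ν + ω - 1 - ((ω + m : ℕ) : ℝ) = ν - 1 - m := by push_cast; ring
  simp only [he]
  rw [Real.rpow_sub hL, Real.rpow_natCast, div_pow, mul_pow, pow_add]
  ring

theorem gTilde_eq {ν : ℝ} (hν : ν ≠ 0) {n ω : ℕ} (hω : ω ≤ n) {z : ℝ} (hz : 0 < z) :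
    gTilde n ω z ν =
      (∏ k ∈ Finset.range (n + 1), (ν + ω - k)) / ν * momentMean (n - ω) ω ν z := by
  rw [gTilde, if_neg hz.ne', g_eq hν hω hz, incGeom_eq_eulerInt hν hz,
    pow_mul_eulerInt_eq_momentInt ν hω hz, momentMean, mul_div_mul_comm]

theorem continuousOn_ratio {z : ℝ} (hz : 0 < z) :
    ContinuousOn (fun t : ℝ => t * z / (1 - t + t * z)) (Icc 0 1) :=
  ContinuousOn.div (by fun_prop) (by fun_prop) fun _ ht => (segment_pos hz ht).ne'

theorem ratio_nonneg {z t : ℝ} (hz : 0 < z) (ht : t ∈ Icc (0 : ℝ) 1) :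
    0 ≤ t * z / (1 - t + t * z) :=
  div_nonneg (mul_nonneg ht.1 hz.le) (segment_pos hz ht).le

theorem ratio_le_one {z t : ℝ} (hz : 0 < z) (ht : t ∈ Icc (0 : ℝ) 1) :
    t * z / (1 - t + t * z) ≤ 1 := by
  rw [div_le_one (segment_pos hz ht)]
  linarith [ht.2]

theorem continuousOn_moment_integrand (m k : ℕ) {z : ℝ} (hz : 0 < z) :
    ContinuousOn (fun t : ℝ => (t * z / (1 - t + t * z)) ^ m * t ^ k) (Icc 0 1) :=
  ((continuousOn_ratio hz).pow m).mul (continuousOn_pow k)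

theorem momentMean_nonneg (m k : ℕ) (ν : ℝ) {z : ℝ} (hz : 0 < z) : 0 ≤ momentMean m k ν z := by
  refine div_nonneg (intervalIntegral.integral_nonneg zero_le_one fun t ht => ?_)
    (eulerInt_zero_pos ν hz).le
  exact mul_nonneg (mul_nonneg (pow_nonneg (ratio_nonneg hz ht) m) (pow_nonneg ht.1 k))
    (Real.rpow_nonneg (segment_pos hz ht).le _)

theorem momentMean_le_one (m k : ℕ) (ν : ℝ) {z : ℝ} (hz : 0 < z) : momentMean m k ν z ≤ 1 := by
  rw [momentMean, div_le_one (eulerInt_zero_pos ν hz), ← momentInt_zero_zero, momentInt, momentInt]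
  have hc (m k : ℕ) := ((continuousOn_moment_integrand m k hz).mul
    (continuousOn_segment_rpow hz (ν - 1))).intervalIntegrable_of_Icc
      (μ := MeasureTheory.volume) zero_le_one
  refine intervalIntegral.integral_mono_on zero_le_one (hc m k) (hc 0 0) fun t ht => ?_
  refine mul_le_mul_of_nonneg_right ?_ (Real.rpow_nonneg (segment_pos hz ht).le _)
  rw [pow_zero, pow_zero, mul_one]
  exact mul_le_one₀ (pow_le_one₀ (ratio_nonneg hz ht) (ratio_le_one hz ht))
    (pow_nonneg ht.1 k) (pow_le_one₀ ht.1 ht.2)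

/-! ### Monotonicity of the means for `ν > 1`. -/

theorem ratio_mono {z z' t : ℝ} (hz : 0 < z) (hzz : z ≤ z') (ht : t ∈ Icc (0 : ℝ) 1) :
    t * z / (1 - t + t * z) ≤ t * z' / (1 - t + t * z') := by
  rw [div_le_div_iff₀ (segment_pos hz ht) (segment_pos (hz.trans_le hzz) ht)]
  have := mul_nonneg (mul_nonneg ht.1 (sub_nonneg.mpr ht.2)) (sub_nonneg.mpr hzz)
  linear_combination this

theorem ratio_strictMonoOn {z : ℝ} (hz : 0 < z) :
    StrictMonoOn (fun t : ℝ => t * z / (1 - t + t * z)) (Icc 0 1) := by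
  intro s hs t ht hst
  simp only
  rw [div_lt_div_iff₀ (segment_pos hz hs) (segment_pos hz ht)]
  have := mul_pos hz (sub_pos.mpr hst)
  linear_combination this

/-- The likelihood ratio of the densities at `z < z'` is strictly increasing. -/
theorem likelihood_strictMonoOn {z z' e : ℝ} (hz : 0 < z) (hzz : z < z') (he : 0 < e) :
    StrictMonoOn (fun t : ℝ => ((1 - t + t * z') / (1 - t + t * z)) ^ e) (Icc 0 1) := by
  intro s hs t ht hst
  have hz' := hz.trans hzz
  refine Real.rpow_lt_rpow (div_pos (segment_pos hz' hs) (segment_pos hz hs)).le ?_ he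
  rw [div_lt_div_iff₀ (segment_pos hz hs) (segment_pos hz ht)]
  have := mul_pos (sub_pos.mpr hst) (sub_pos.mpr hzz)
  linear_combination this

theorem continuousOn_likelihood {z z' : ℝ} (hz : 0 < z) (hz' : 0 < z') (e : ℝ) :
    ContinuousOn (fun t : ℝ => ((1 - t + t * z') / (1 - t + t * z)) ^ e) (Icc 0 1) :=
  ContinuousOn.rpow_const
    (ContinuousOn.div (by fun_prop) (by fun_prop) fun t ht => (segment_pos hz ht).ne')
    fun t ht => Or.inl (div_pos (segment_pos hz' ht) (segment_pos hz ht)).ne'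

theorem likelihood_mul {z z' t : ℝ} (hz : 0 < z) (hz' : 0 < z') (e : ℝ) (ht : t ∈ Icc (0 : ℝ) 1) :
    ((1 - t + t * z') / (1 - t + t * z)) ^ e * (1 - t + t * z) ^ e = (1 - t + t * z') ^ e := by
  rw [← Real.mul_rpow (div_pos (segment_pos hz' ht) (segment_pos hz ht)).le (segment_pos hz ht).le,
    div_mul_cancel₀ _ (segment_pos hz ht).ne']

theorem integral_likelihood_mul {z z' : ℝ} (hz : 0 < z) (hz' : 0 < z') (e : ℝ) (h : ℝ → ℝ) :
    ∫ t in (0 : ℝ)..1, h t * (((1 - t + t * z') / (1 - t + t * z)) ^ e * (1 - t + t * z) ^ e) =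
      ∫ t in (0 : ℝ)..1, h t * (1 - t + t * z') ^ e := by
  refine intervalIntegral.integral_congr fun t ht => ?_
  rw [uIcc_of_le zero_le_one] at ht
  simp only [likelihood_mul hz hz' e ht]

/-- Means with respect to the densities `(1 - t + t z)ᵉ` of an increasing function increase
with `z`. -/
theorem integral_mul_le_of_monotoneOn {z z' e : ℝ} (hz : 0 < z) (hzz : z < z') (he : 0 < e)
    {h : ℝ → ℝ} (hc : ContinuousOn h (Icc 0 1)) (hm : MonotoneOn h (Icc 0 1)) :
    (∫ t in (0 : ℝ)..1, h t * (1 - t + t * z) ^ e) * (∫ t in (0 : ℝ)..1, (1 - t + t * z') ^ e) ≤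
    (∫ t in (0 : ℝ)..1, h t * (1 - t + t * z') ^ e) * ∫ t in (0 : ℝ)..1, (1 - t + t * z) ^ e := by
  have hz' := hz.trans hzz
  have key := chebyshev_integral_le zero_le_one hc (continuousOn_likelihood hz hz' e)
    (continuousOn_segment_rpow hz e) (fun t ht => Real.rpow_nonneg (segment_pos hz ht).le _)
    hm (likelihood_strictMonoOn hz hzz he).monotoneOn
  have h1 := integral_likelihood_mul hz hz' e fun _ => 1
  simp only [one_mul] at h1
  rwa [integral_likelihood_mul hz hz', h1] at key

theorem integral_mul_lt_of_strictMonoOn {z z' e : ℝ} (hz : 0 < z) (hzz : z < z') (he : 0 < e)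
    {h : ℝ → ℝ} (hc : ContinuousOn h (Icc 0 1)) (hm : StrictMonoOn h (Icc 0 1)) :
    (∫ t in (0 : ℝ)..1, h t * (1 - t + t * z) ^ e) * (∫ t in (0 : ℝ)..1, (1 - t + t * z') ^ e) <
    (∫ t in (0 : ℝ)..1, h t * (1 - t + t * z') ^ e) * ∫ t in (0 : ℝ)..1, (1 - t + t * z) ^ e := by
  have hz' := hz.trans hzz
  have key := chebyshev_integral_lt zero_lt_one hc (continuousOn_likelihood hz hz' e)
    (continuousOn_segment_rpow hz e) (fun t ht => Real.rpow_pos_of_pos (segment_pos hz ht) _)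
    hm (likelihood_strictMonoOn hz hzz he)
  have h1 := integral_likelihood_mul hz hz' e fun _ => 1
  simp only [one_mul] at h1
  rwa [integral_likelihood_mul hz hz', h1] at key

theorem eulerInt_zero_eq (ν z : ℝ) :
    eulerInt ν 0 z = ∫ t in (0 : ℝ)..1, (1 - t + t * z) ^ (ν - 1) := by
  simp [eulerInt]

theorem momentInt_integrand_monotoneOn (m k : ℕ) {z : ℝ} (hz : 0 < z) :
    MonotoneOn (fun t : ℝ => (t * z / (1 - t + t * z)) ^ m * t ^ k) (Icc 0 1) :=
  fun _ hs _ ht hst => mul_le_mul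
    (pow_le_pow_left₀ (ratio_nonneg hz hs) ((ratio_strictMonoOn hz).monotoneOn hs ht hst) m)
    (pow_le_pow_left₀ hs.1 hst k) (pow_nonneg hs.1 k) (pow_nonneg (ratio_nonneg hz ht) m)

theorem integral_moment_le (m k : ℕ) (e : ℝ) {z z' : ℝ} (hz : 0 < z) (hzz : z < z') :
    ∫ t in (0 : ℝ)..1, (t * z / (1 - t + t * z)) ^ m * t ^ k * (1 - t + t * z') ^ e ≤
      ∫ t in (0 : ℝ)..1, (t * z' / (1 - t + t * z')) ^ m * t ^ k * (1 - t + t * z') ^ e := by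
  have hz' := hz.trans hzz
  have hc {y : ℝ} (hy : 0 < y) := ((continuousOn_moment_integrand m k hy).mul
    (continuousOn_segment_rpow hz' e)).intervalIntegrable_of_Icc
      (μ := MeasureTheory.volume) zero_le_one
  refine intervalIntegral.integral_mono_on zero_le_one (hc hz) (hc hz') fun t ht => ?_
  refine mul_le_mul_of_nonneg_right ?_ (Real.rpow_nonneg (segment_pos hz' ht).le _)
  exact mul_le_mul_of_nonneg_right
    (pow_le_pow_left₀ (ratio_nonneg hz ht) (ratio_mono hz hzz.le ht) m) (pow_nonneg ht.1 k)

/-- Two moves: change the density from `z` to `z'` with the averaged function fixed (Chebyshev),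
then change the function under the density at `z'`. -/
theorem momentMean_monotoneOn (m k : ℕ) {ν : ℝ} (hν : 1 < ν) :
    MonotoneOn (momentMean m k ν) (Ioi 0) := by
  intro z hz z' hz' hzz
  rcases hzz.eq_or_lt with rfl | hzz
  · exact le_rfl
  rw [momentMean, momentMean, div_le_div_iff₀ (eulerInt_zero_pos ν hz) (eulerInt_zero_pos ν hz'),
    eulerInt_zero_eq, eulerInt_zero_eq]
  refine (integral_mul_le_of_monotoneOn hz hzz (sub_pos.mpr hν)
    (continuousOn_moment_integrand m k hz) (momentInt_integrand_monotoneOn m k hz)).trans ?_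
  rw [← eulerInt_zero_eq ν z]
  exact mul_le_mul_of_nonneg_right (integral_moment_le m k _ hz hzz) (eulerInt_zero_pos ν hz).le

/-- When `m + k = 1` the averaged function is `t` or the ratio itself, both strictly increasing in
`t`, so the Chebyshev move is strict. -/
theorem momentMean_strictMonoOn {m k : ℕ} (hmk : m + k = 1) {ν : ℝ} (hν : 1 < ν) :
    StrictMonoOn (momentMean m k ν) (Ioi 0) := by
  intro z hz z' hz' hzz
  have hm : StrictMonoOn (fun t : ℝ => (t * z / (1 - t + t * z)) ^ m * t ^ k) (Icc 0 1) := by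
    obtain ⟨rfl, rfl⟩ | ⟨rfl, rfl⟩ : (m = 0 ∧ k = 1) ∨ (m = 1 ∧ k = 0) := by lia
    · intro s _ t _ hst
      simpa using hst
    · simpa using ratio_strictMonoOn hz
  rw [momentMean, momentMean, div_lt_div_iff₀ (eulerInt_zero_pos ν hz) (eulerInt_zero_pos ν hz'),
    eulerInt_zero_eq, eulerInt_zero_eq]
  refine (integral_mul_lt_of_strictMonoOn hz hzz (sub_pos.mpr hν)
    (continuousOn_moment_integrand m k hz) hm).trans_le ?_
  rw [← eulerInt_zero_eq ν z]
  exact mul_le_mul_of_nonneg_right (integral_moment_le m k _ hz hzz) (eulerInt_zero_pos ν hz).le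

/-! ### Reflection `z ↦ z⁻¹` and the case `ν < -1`. -/

/-- The substitution `t = s / (s + z (1 - s))` exchanges `(m, k, ν, z)` and `(k, m, -ν, z⁻¹)`. -/
theorem momentInt_eq_inv_mul (m k : ℕ) (ν : ℝ) {z : ℝ} (hz : 0 < z) :
    momentInt m k ν z = z⁻¹ * momentInt k m (-ν) z⁻¹ := by
  have hy := inv_pos.mpr hz
  have hφ : ∀ s ∈ uIcc (0 : ℝ) 1, HasDerivAt (fun s : ℝ => s * z⁻¹ / (1 - s + s * z⁻¹))
      (z⁻¹ / (1 - s + s * z⁻¹) ^ 2) s := by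
    intro s hs
    rw [uIcc_of_le zero_le_one] at hs
    have hL := (segment_pos hy hs).ne'
    have h1 : HasDerivAt (fun s : ℝ => 1 - s + s * z⁻¹) (-1 + 1 * z⁻¹) s :=
      ((hasDerivAt_id s).const_sub 1).add ((hasDerivAt_id s).mul_const _)
    convert! ((hasDerivAt_id s).mul_const z⁻¹).div h1 hL using 1
    simp only [id]
    ring
  have hmaps : MapsTo (fun s : ℝ => s * z⁻¹ / (1 - s + s * z⁻¹)) (uIcc 0 1) (Icc 0 1) := by
    intro s hs
    rw [uIcc_of_le zero_le_one] at hs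
    exact ⟨ratio_nonneg hy hs, ratio_le_one hy hs⟩
  have hsub := intervalIntegral.integral_comp_mul_deriv' hφ
    (by
      rw [uIcc_of_le zero_le_one]
      exact ContinuousOn.div continuousOn_const (by fun_prop)
        fun s hs => (pow_pos (segment_pos hy hs) 2).ne')
    (g := fun t => (t * z / (1 - t + t * z)) ^ m * t ^ k * (1 - t + t * z) ^ (ν - 1))
    (((continuousOn_moment_integrand m k hz).mul (continuousOn_segment_rpow hz (ν - 1))).mono
      hmaps.image_subset)
  have h1 : (1 : ℝ) * z⁻¹ / (1 - 1 + 1 * z⁻¹) = 1 := by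
    rw [sub_self, zero_add, one_mul, div_self hy.ne']
  rw [zero_mul, zero_div, h1] at hsub
  rw [momentInt, ← hsub, momentInt, ← intervalIntegral.integral_const_mul]
  refine intervalIntegral.integral_congr fun s hs => ?_
  rw [uIcc_of_le zero_le_one] at hs
  have hL := segment_pos hy hs
  simp only [Function.comp_apply]
  set l := 1 - s + s * z⁻¹ with hl
  have hseg : 1 - s * z⁻¹ / l + s * z⁻¹ / l * z = l⁻¹ := by
    field_simp
    rw [hl]
    field_simp
    ring
  have hrat : s * z⁻¹ / l * z / l⁻¹ = s := by
    field_simp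
  have hpow : l⁻¹ ^ (ν - 1) * (z⁻¹ / l ^ 2) = z⁻¹ * l ^ (-ν - 1) := by
    rw [Real.inv_rpow hL.le, ← Real.rpow_neg hL.le, show -ν - 1 = -(ν - 1) - (2 : ℕ) by
      push_cast; ring, Real.rpow_sub hL, Real.rpow_natCast]
    ring
  rw [hseg, hrat, mul_assoc, hpow]
  ring

theorem momentMean_eq_inv (m k : ℕ) (ν : ℝ) {z : ℝ} (hz : 0 < z) :
    momentMean m k ν z = momentMean k m (-ν) z⁻¹ := by
  rw [momentMean, momentMean, ← momentInt_zero_zero, ← momentInt_zero_zero,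
    momentInt_eq_inv_mul m k ν hz, momentInt_eq_inv_mul 0 0 ν hz,
    mul_div_mul_left _ _ (inv_ne_zero hz.ne')]

theorem momentMean_antitoneOn (m k : ℕ) {ν : ℝ} (hν : ν < -1) :
    AntitoneOn (momentMean m k ν) (Ioi 0) := by
  intro z hz z' hz' hzz
  rw [momentMean_eq_inv m k ν hz, momentMean_eq_inv m k ν hz']
  exact momentMean_monotoneOn k m (lt_neg_of_lt_neg hν) (mem_Ioi.mpr (inv_pos.mpr hz'))
    (mem_Ioi.mpr (inv_pos.mpr hz)) (inv_anti₀ hz hzz)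

theorem momentMean_strictAntiOn {m k : ℕ} (hmk : m + k = 1) {ν : ℝ} (hν : ν < -1) :
    StrictAntiOn (momentMean m k ν) (Ioi 0) := by
  intro z hz z' hz' hzz
  rw [momentMean_eq_inv m k ν hz, momentMean_eq_inv m k ν hz']
  exact momentMean_strictMonoOn (by lia) (lt_neg_of_lt_neg hν)
    (mem_Ioi.mpr (inv_pos.mpr hz')) (mem_Ioi.mpr (inv_pos.mpr hz)) (inv_strictAnti₀ hz hzz)

/-! ### The endpoint `z = 0` and the conclusion. -/

theorem strictMonoOn_Ici_of_Ioi {a : ℝ} {f : ℝ → ℝ} (h : MonotoneOn f (Ici a))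
    (hs : StrictMonoOn f (Ioi a)) : StrictMonoOn f (Ici a) := by
  intro x hx y hy hxy
  obtain ⟨c, hxc, hcy⟩ := exists_between hxy
  have hc : a < c := lt_of_le_of_lt hx hxc
  exact (h hx hc.le hxc.le).trans_lt (hs hc (hc.trans hcy) hcy)

/-- Since `limUnder` has a value even when no limit exists, continuity at `0` is what records that
the limit defining `g̃` at `0` is genuine. -/
theorem gTilde_continuousWithinAt {ν : ℝ} (hν : ν ≠ 0) {n ω : ℕ} (hω : ω ≤ n) {l : ℝ}
    (hl : Tendsto (momentMean (n - ω) ω ν) (𝓝[>] 0) (𝓝 l)) :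
    ContinuousWithinAt (fun z => gTilde n ω z ν) (Ici 0) 0 := by
  have ht : Tendsto (fun z => gTilde n ω z ν) (𝓝[>] 0)
      (𝓝 ((∏ k ∈ Finset.range (n + 1), (ν + ω - k)) / ν * l)) := by
    refine (hl.const_mul _).congr' ?_
    filter_upwards [self_mem_nhdsWithin] with z hz using (gTilde_eq hν hω hz).symm
  have h0 : gTilde n ω 0 ν = (∏ k ∈ Finset.range (n + 1), (ν + ω - k)) / ν * l := by
    rw [gTilde, if_pos rfl]
    refine Tendsto.limUnder_eq (ht.congr' ?_)
    filter_upwards [self_mem_nhdsWithin] with z hz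
    rw [gTilde, if_neg (ne_of_gt hz)]
  rw [← continuousWithinAt_Ioi_iff_Ici, ContinuousWithinAt, h0]
  exact ht

theorem abs_gTilde_eqOn {ν : ℝ} (hν : ν ≠ 0) {n ω : ℕ} (hω : ω ≤ n) :
    EqOn (fun z => |gTilde n ω z ν|)
      (fun z => |(∏ k ∈ Finset.range (n + 1), (ν + ω - k)) / ν| * momentMean (n - ω) ω ν z)
      (Ioi 0) := fun z hz => by
  simp only [gTilde_eq hν hω hz, abs_mul, abs_of_nonneg (momentMean_nonneg (n - ω) ω ν hz)]

theorem gTilde_monotone {ν : ℝ} (hν : 1 < ν) {n ω : ℕ} (hω : ω ≤ n) :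
    ContinuousWithinAt (fun z => gTilde n ω z ν) (Ici 0) 0 ∧
      MonotoneOn (fun z => |gTilde n ω z ν|) (Ici 0) := by
  have hν0 : ν ≠ 0 := by linarith
  have hm := momentMean_monotoneOn (n - ω) ω hν
  -- An increasing function bounded below by `0` has a finite right limit at `0`; for `ν < -1` the
  -- bound is `1` from above.
  have hc := gTilde_continuousWithinAt hν0 hω (hm.tendsto_nhdsGT
    ⟨0, forall_mem_image.mpr fun z hz => momentMean_nonneg (n - ω) ω ν hz⟩)
  refine ⟨hc, ?_⟩
  rw [← Ioi_insert]
  refine MonotoneOn.insert_of_continuousWithinAt ?_ (inferInstanceAs (𝓝[>] (0 : ℝ)).NeBot)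
    (hc.mono Ioi_subset_Ici_self).abs
  refine MonotoneOn.congr ?_ (abs_gTilde_eqOn hν0 hω).symm
  exact fun x hx y hy hxy => mul_le_mul_of_nonneg_left (hm hx hy hxy) (abs_nonneg _)

theorem gTilde_antitone {ν : ℝ} (hν : ν < -1) {n ω : ℕ} (hω : ω ≤ n) :
    ContinuousWithinAt (fun z => gTilde n ω z ν) (Ici 0) 0 ∧
      AntitoneOn (fun z => |gTilde n ω z ν|) (Ici 0) := by
  have hν0 : ν ≠ 0 := by linarith
  have hm := momentMean_antitoneOn (n - ω) ω hν
  have hc := gTilde_continuousWithinAt hν0 hω (hm.tendsto_nhdsGT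
    ⟨1, forall_mem_image.mpr fun z hz => momentMean_le_one (n - ω) ω ν hz⟩)
  refine ⟨hc, ?_⟩
  have ha : AntitoneOn (fun z => |gTilde n ω z ν|) (Ioi 0) := by
    refine AntitoneOn.congr ?_ (abs_gTilde_eqOn hν0 hω).symm
    exact fun x hx y hy hxy => mul_le_mul_of_nonneg_left (hm hx hy hxy) (abs_nonneg _)
  rw [← Ioi_insert]
  simpa using (MonotoneOn.insert_of_continuousWithinAt ha.neg
    (inferInstanceAs (𝓝[>] (0 : ℝ)).NeBot) (hc.mono Ioi_subset_Ici_self).abs.neg).neg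

/-- For `n = ω = 1` the constant is `(ν + 1) ν / ν = ν + 1`; for other pairs it may vanish, and
strictness is then lost. -/
theorem abs_coeff_one_one_pos {ν : ℝ} (h0 : ν ≠ 0) (h1 : ν ≠ -1) :
    0 < |(∏ k ∈ Finset.range (1 + 1), (ν + (1 : ℕ) - k)) / ν| := by
  have : ν + 1 ≠ 0 := fun h => h1 (by linarith)
  simp [Finset.prod_range_succ, h0, this]

theorem gTilde_one_one_strictMonoOn {ν : ℝ} (hν : 1 < ν) :
    StrictMonoOn (fun z => |gTilde 1 1 z ν|) (Ici 0) := by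
  have hν0 : ν ≠ 0 := by linarith
  refine strictMonoOn_Ici_of_Ioi (gTilde_monotone hν le_rfl).2 ?_
  refine StrictMonoOn.congr ?_ (abs_gTilde_eqOn hν0 le_rfl).symm
  exact fun x hx y hy hxy => mul_lt_mul_of_pos_left
    (momentMean_strictMonoOn rfl hν hx hy hxy) (abs_coeff_one_one_pos hν0 (by linarith))

theorem gTilde_one_one_strictAntiOn {ν : ℝ} (hν : ν < -1) :
    StrictAntiOn (fun z => |gTilde 1 1 z ν|) (Ici 0) := by
  have hν0 : ν ≠ 0 := by linarith
  have hs : StrictAntiOn (fun z => |gTilde 1 1 z ν|) (Ioi 0) := by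
    refine StrictAntiOn.congr ?_ (abs_gTilde_eqOn hν0 le_rfl).symm
    exact fun x hx y hy hxy => mul_lt_mul_of_pos_left
      (momentMean_strictAntiOn rfl hν hx hy hxy) (abs_coeff_one_one_pos hν0 hν.ne)
  simpa using (strictMonoOn_Ici_of_Ioi (gTilde_antitone hν le_rfl).2.neg hs.neg).neg

end FracGeom

theorem mainTheorem8 (ν : ℝ) :
    (1 < ν →
      (∀ n ω : ℕ, ω ≤ n →
        ContinuousWithinAt (fun z => FracGeom.gTilde n ω z ν) (Ici 0) 0 ∧
        MonotoneOn (fun z => |FracGeom.gTilde n ω z ν|) (Ici 0)) ∧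
      ∃ n ω : ℕ, ω ≤ n ∧ StrictMonoOn (fun z => |FracGeom.gTilde n ω z ν|) (Ici 0)) ∧
    (ν < -1 →
      (∀ n ω : ℕ, ω ≤ n →
        ContinuousWithinAt (fun z => FracGeom.gTilde n ω z ν) (Ici 0) 0 ∧
        AntitoneOn (fun z => |FracGeom.gTilde n ω z ν|) (Ici 0)) ∧
      ∃ n ω : ℕ, ω ≤ n ∧ StrictAntiOn (fun z => |FracGeom.gTilde n ω z ν|) (Ici 0)) := by
  exact ⟨fun hν => ⟨fun _ _ hω => FracGeom.gTilde_monotone hν hω,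
      1, 1, le_rfl, FracGeom.gTilde_one_one_strictMonoOn hν⟩,
    fun hν => ⟨fun _ _ hω => FracGeom.gTilde_antitone hν hω,
      1, 1, le_rfl, FracGeom.gTilde_one_one_strictAntiOn hν⟩⟩
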